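/- Let $H$ be a complex Hilbert space. For a bounded operator $T$ on $H$ let $\nu(T)=\sup\{|\langle Tx,x\rangle| : \|x\|=1\}$ be its numerical radius. A class $\mathcal A\subset\mathcal L(H)$ being given, $H$ is said to have the BPBpp-$\nu$ (Bishop–Phelps–Bollobás point property for numerical radius) for $\mathcal A$ if for every $\varepsilon>0$ there is $\eta>0$ such that whenever $T\in\mathcal A$ with $\nu(T)=1$ and $x_0\in H$ with $\|x_0\|=1$ satisfy $|\langle Tx_0,x_0\rangle|>1-\eta$, there is $S\in\mathcal A$ with $\nu(S)=1$, $|\langle Sx_0,x_0\rangle|=1$ and $\|S-T\|<\varepsilon$. For $1\le p<\infty$, the Schatten–von Neumann class $S_p(H)$ consists of the compact operators $T$ with $\sigma_p(T)=\bigl(\sum_j\lambda_j^p\bigr)^{1/p}<\infty$, where $(\lambda_j)$ are the non-zero eigenvalues of $|T|=(T^*T)^{1/2}$, counted with multiplicity. Then: (a) $H$ has the BPBpp-$\nu$ for positive operators. (b) $H$ has the BPBpp-$\nu$ for positive Schatten–von Neumann operators, that is, for the class of positive operators in $S_p(H)$, for every $1\le p<\infty$, and also for the class of positive operators in $\bigcup_{1\le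 p<\infty}S_p(H)$. (c) $H$ has the BPBpp-$\nu$ for compact positive operators. (d) $H$ has the BPBpp-$\nu$ for self-adjoint Schatten–von Neumann operators, that is, for the class of self-adjoint operators in $S_p(H)$, for every $1\le p<\infty$, and also for the class of self-adjoint operators in $\bigcup_{1\le p<\infty}S_p(H)$. Moreover, for every $\varepsilon\in(0,1)$ there is $\eta>0$ such that, whenever $T$ is a positive operator with $\nu(T)=1$ and $x_0$ is a unit vector with $|\langle Tx_0,x_0\rangle|>1-\eta$, there are unit vectors $x_1,x_2,\dots$ converging to a unit vector $x_\infty$ such that the operators $$T_n=T+K_n,\qquad K_n=\sum_{k=1}^n\Bigl(\frac{\varepsilon}{4}\Bigr)^k\langle\,\cdot\,,x_k\rangle x_k ,$$ with $K_n$ and $T_n$ positive, converge in norm to an operator $T_\infty$ with $\nu(T_\infty)=\lim_n\nu(T_n)=\lim_n|\langle T_nx_n,x_n\rangle|>0$, and $\widetilde S=T_\infty/\nu(T_\infty)$ is a positive operator with $\nu(\widetilde S)=\langle\widetilde Sx_\infty,x_\infty\rangle=1$, $\|x_\infty-x_0\|<\varepsilon$ and $\|\widetilde S-T\|<\varepsilon$.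 -/

import Mathlib

open Filter Topology
open scoped ENNReal

noncomputable section

namespace BPB

variable {H : Type*} [NormedAddCommGroup H] [InnerProductSpace ℂ H]

/-- The numerical radius `ν(T) = sup { |⟨T x, x⟩| : ‖x‖ = 1 }`. For a bounded operator the set is
bounded above by `‖T‖`, and it is nonempty as soon as `H ≠ 0`. (Mathlib's inner product is linear
in the second variable, so `⟨T x, x⟩` is written `inner ℂ x (T x)`.) -/
def numericalRadius (T : H →L[ℂ] H) : ℝ :=
  sSup {r : ℝ | ∃ x : H, ‖x‖ = 1 ∧ r = ‖inner ℂ x (T x)‖}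

/-- The Bishop-Phelps-Bollobás point property for numerical radius, for a class `A` of bounded
operators on `H`. -/
def BPBppNu (A : Set (H →L[ℂ] H)) : Prop :=
  ∀ ε : ℝ, 0 < ε → ∃ η : ℝ, 0 < η ∧
    ∀ T ∈ A, numericalRadius T = 1 →
      ∀ x₀ : H, ‖x₀‖ = 1 → 1 - η < ‖inner ℂ x₀ (T x₀)‖ →
        ∃ S ∈ A, numericalRadius S = 1 ∧ ‖inner ℂ x₀ (S x₀)‖ = 1 ∧ ‖S - T‖ < ε

/-- The multiplicity of the real number `μ` as an eigenvalue of `T` (it is `0` if `μ` is not an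
eigenvalue; for compact `T` and `μ ≠ 0` the eigenspace is finite dimensional). -/
def eigenMultiplicity (T : H →L[ℂ] H) (μ : ℝ) : ℕ :=
  Module.finrank ℂ (Module.End.eigenspace (T : H →ₗ[ℂ] H) (μ : ℂ))

/-- The finite-rank operator
`δ ⟨·, x₁⟩ x₁ + δ² ⟨·, x₂⟩ x₂ + ⋯ + δⁿ ⟨·, xₙ⟩ xₙ`. -/
def finiteRankPerturbation (δ : ℝ) (x : ℕ → H) (n : ℕ) : H →L[ℂ] H :=
  ∑ k ∈ Finset.Icc 1 n, ((δ : ℂ) ^ k) • InnerProductSpace.rankOne ℂ (x k) (x k)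

variable [CompleteSpace H]

/-- The Schatten `p`-norm `σ_p(T) = (∑ λ_j ^ p) ^ (1 / p)` of a compact operator, where the `λ_j`
are the non-zero eigenvalues of `|T| = (T* T)^{1/2}` counted with multiplicity; as a number in
`[0, ∞]`. The sum is arranged over the distinct values `μ > 0`, each with its multiplicity. -/
def schattenNorm (p : ℝ) (T : H →L[ℂ] H) : ℝ≥0∞ :=
  (∑' μ : {μ : ℝ // 0 < μ},
    (eigenMultiplicity (CFC.abs T) μ : ℝ≥0∞) * ENNReal.ofReal (μ : ℝ) ^ p) ^ (1 / p)

variable (H) in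
/-- The Schatten-von Neumann class `S_p(H)`: the compact operators with `σ_p(T) < ∞`. -/
def schattenClass (p : ℝ) : Set (H →L[ℂ] H) :=
  {T | IsCompactOperator T ∧ schattenNorm p T < ∞}

end BPB

end

/-! ### Numerical radius, and replacing the diagonal entry at a unit vector -/

namespace BPB

open InnerProductSpace ContinuousLinearMap

variable {H : Type*} [NormedAddCommGroup H] [InnerProductSpace ℂ H]

/-! For self-adjoint `T` with `ν(T) = ‖T‖ = 1`, if `|⟨Te, e⟩|` is near `1` and `s` is the sign of
`⟨Te, e⟩`, then `u = s e - T e` is small, because `‖u‖² ≤ 2(1 - s⟨Te, e⟩)`. So `e` is almost an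
eigenvector, and `S = sP + QTQ`, with `P` the projection on `e` and `Q = 1 - P`, has `e` as an exact
one. Pythagoras gives `ν(S) = 1`, while `S - T` is a sum of rank-one terms built from `u` and `e`,
hence of norm at most `3‖u‖` (`norm_compression_sub_le`). All six classes are thus handled by
showing that they are stable under this one construction (`bppNu_of_compression_mem`).

The only nontrivial stability is that of `S_p`. Finiteness of the Schatten norm is recast as
`p`-summability of the diagonal of `T` along every orthonormal family (`schattenNorm_lt_top_iff`), a
condition linear in `T` and satisfied by rank-one operators.

For the series of perturbations, one step suffices: `A = T + δ⟨·, e⟩e` has norm above `‖T‖`, so by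
the Fredholm alternative its norm is an eigenvalue (`exists_eigenvector_norm_of_norm_lt`), with a
unit eigenvector `z` close to `e`. Taking `z` for every later vector keeps it a top eigenvector, and
all limits become geometric sums. -/

theorem bddAbove_numericalRadius (T : H →L[ℂ] H) :
    BddAbove {r : ℝ | ∃ x : H, ‖x‖ = 1 ∧ r = ‖inner ℂ x (T x)‖} := by
  refine ⟨‖T‖, ?_⟩
  rintro r ⟨x, hx, rfl⟩
  calc ‖inner ℂ x (T x)‖ ≤ ‖x‖ * ‖T x‖ := norm_inner_le_norm _ _
    _ ≤ 1 * (‖T‖ * 1) := by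
      rw [hx]; gcongr; simpa [hx] using T.le_opNorm x
    _ = ‖T‖ := by ring

theorem numericalRadius_nonneg (T : H →L[ℂ] H) : 0 ≤ numericalRadius T :=
  Real.sSup_nonneg (by rintro r ⟨x, -, rfl⟩; positivity)

theorem norm_inner_le_numericalRadius (T : H →L[ℂ] H) (x : H) :
    ‖inner ℂ x (T x)‖ ≤ numericalRadius T * ‖x‖ ^ 2 := by
  by_cases hx : x = 0
  · simp [hx]
  have hx' : 0 < ‖x‖ := norm_pos_iff.mpr hx
  have h1 : ‖inner ℂ ((‖x‖⁻¹ : ℂ) • x) (T ((‖x‖⁻¹ : ℂ) • x))‖ ≤ numericalRadius T :=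
    le_csSup (bddAbove_numericalRadius T) ⟨_, by simp [norm_smul, hx'.ne'], rfl⟩
  simp only [map_smul, inner_smul_left, inner_smul_right, norm_mul, map_inv₀, Complex.conj_ofReal,
    norm_inv, Complex.norm_real, norm_norm] at h1
  calc ‖inner ℂ x (T x)‖ = (‖x‖⁻¹ * (‖x‖⁻¹ * ‖inner ℂ x (T x)‖)) * ‖x‖ ^ 2 := by field_simp
    _ ≤ _ := by gcongr

theorem numericalRadius_le_norm (T : H →L[ℂ] H) : numericalRadius T ≤ ‖T‖ := by
  refine Real.sSup_le ?_ (norm_nonneg _)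
  rintro r ⟨x, hx, rfl⟩
  calc ‖inner ℂ x (T x)‖ ≤ ‖x‖ * ‖T x‖ := norm_inner_le_norm _ _
    _ ≤ 1 * (‖T‖ * 1) := by
      rw [hx]; gcongr; simpa [hx] using T.le_opNorm x
    _ = ‖T‖ := by ring

/-- The norm of a symmetric operator is the supremum of its absolute Rayleigh quotients, each
bounded by the numerical radius. -/
theorem numericalRadius_eq_norm {T : H →L[ℂ] H} (hT : T.IsSymmetric) :
    numericalRadius T = ‖T‖ := by
  refine le_antisymm (numericalRadius_le_norm T) ?_
  rw [norm_eq_iSup_rayleighQuotient T hT]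
  refine ciSup_le fun x => ?_
  by_cases hx : x = 0
  · simpa [hx] using numericalRadius_nonneg T
  have hx' : 0 < ‖x‖ := norm_pos_iff.mpr hx
  rw [rayleighQuotient, abs_div, abs_sq, div_le_iff₀ (by positivity)]
  refine le_trans ?_ (norm_inner_le_numericalRadius T x)
  rw [reApplyInnerSelf_apply, ← norm_inner_symm]
  exact RCLike.abs_re_le_norm _

/-- The operator `s P + Q T Q`, where `P` is the projection on the line spanned by the unit
vector `e` and `Q = 1 - P`. -/
noncomputable def compression (s : ℝ) (e : H) (T : H →L[ℂ] H) : H →L[ℂ] H :=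
  (s : ℂ) • rankOne ℂ e e + (1 - rankOne ℂ e e) ∘L T ∘L (1 - rankOne ℂ e e)

theorem compression_apply_self (s : ℝ) {e : H} (he : ‖e‖ = 1) (T : H →L[ℂ] H) :
    compression s e T e = (s : ℂ) • e := by
  simp [compression, inner_self_eq_norm_sq_to_K, he]

theorem norm_sub_rankOne_sq {e : H} (he : ‖e‖ = 1) (x : H) :
    ‖inner ℂ e x‖ ^ 2 + ‖x - inner ℂ e x • e‖ ^ 2 = ‖x‖ ^ 2 := by
  rw [@norm_sub_sq ℂ, inner_smul_right, norm_smul, he, ← inner_conj_symm x e, Complex.mul_conj,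
    Complex.normSq_eq_norm_sq]
  simp only [RCLike.re_to_complex, Complex.ofReal_re]
  ring

theorem inner_compression (s : ℝ) (e : H) (T : H →L[ℂ] H) (x : H) :
    inner ℂ x (compression s e T x) = s * (‖inner ℂ e x‖ ^ 2 : ℝ) +
      inner ℂ (x - inner ℂ e x • e) (T (x - inner ℂ e x • e)) := by
  have h1 : inner ℂ e x * inner ℂ x e = ((‖inner ℂ e x‖ ^ 2 : ℝ) : ℂ) := by
    rw [← inner_conj_symm x e, Complex.mul_conj, Complex.normSq_eq_norm_sq]
  rw [← h1]
  simp only [compression, add_apply, smul_apply, comp_apply, sub_apply, one_apply_eq_self, rankOne_apply,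
    inner_add_right, inner_smul_right, inner_sub_left, inner_smul_left, inner_sub_right,
    inner_conj_symm]
  ring

theorem isCompactOperator_rankOne (a b : H) : IsCompactOperator (rankOne ℂ a b) := by
  rw [rankOne_def']
  exact ((isCompactOperator_id (E := ℂ)).comp_clm (innerSL ℂ b)).clm_comp (.toSpanSingleton ℂ a)

theorem isCompactOperator_compression (s : ℝ) (e : H) {T : H →L[ℂ] H} (hT : IsCompactOperator T) :
    IsCompactOperator (compression s e T) := by
  have h (Q : H →L[ℂ] H) : IsCompactOperator (Q ∘L T ∘L Q) := by
    rw [ContinuousLinearMap.coe_comp, ContinuousLinearMap.coe_comp]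
    exact (hT.comp_clm Q).clm_comp Q
  exact ((isCompactOperator_rankOne e e).smul (s : ℂ)).add (h _)

/-- The quadratic form splits without cross terms into its values on the components of `x` along `e`
and orthogonal to `e`; each is bounded by the squared norm of its component. -/
theorem norm_inner_compression_le {s : ℝ} (hs : |s| = 1) {e : H} (he : ‖e‖ = 1)
    {T : H →L[ℂ] H} (hT : numericalRadius T = 1) (x : H) :
    ‖inner ℂ x (compression s e T x)‖ ≤ ‖x‖ ^ 2 := by
  rw [inner_compression, ← norm_sub_rankOne_sq he x]
  refine (norm_add_le _ _).trans ?_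
  have := norm_inner_le_numericalRadius T (x - inner ℂ e x • e)
  rw [hT, one_mul] at this
  simp only [norm_mul, Complex.norm_real, Real.norm_eq_abs, hs, one_mul, abs_sq]
  linarith

theorem norm_inner_compression_self {s : ℝ} (hs : |s| = 1) {e : H} (he : ‖e‖ = 1)
    (T : H →L[ℂ] H) : ‖inner ℂ e (compression s e T e)‖ = 1 := by
  simp [compression_apply_self s he, inner_self_eq_norm_sq_to_K, he, hs]

theorem numericalRadius_compression {s : ℝ} (hs : |s| = 1) {e : H} (he : ‖e‖ = 1)
    {T : H →L[ℂ] H} (hT : numericalRadius T = 1) : numericalRadius (compression s e T) = 1 := by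
  refine IsGreatest.csSup_eq ⟨⟨e, he, (norm_inner_compression_self hs he T).symm⟩, ?_⟩
  rintro r ⟨x, hx, rfl⟩
  simpa [hx] using norm_inner_compression_le hs he hT x

theorem norm_smul_sub_apply_sq_le {s : ℝ} (hs : |s| = 1) {e : H} (he : ‖e‖ = 1) {T : H →L[ℂ] H}
    (hT : ‖T‖ ≤ 1) : ‖(s : ℂ) • e - T e‖ ^ 2 ≤ 2 * (1 - s * (inner ℂ e (T e)).re) := by
  have h1 : ‖T e‖ ≤ 1 := by simpa [he] using T.le_of_opNorm_le hT e
  rw [@norm_sub_sq ℂ, inner_smul_left, norm_smul, he]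
  simp [hs]
  nlinarith [norm_nonneg (T e)]

variable [CompleteSpace H]

theorem isSelfAdjoint_one_sub_rankOne (e : H) : IsSelfAdjoint (1 - rankOne ℂ e e : H →L[ℂ] H) :=
  .sub (.one _) (isPositive_rankOne_self e).isSelfAdjoint

theorem isSelfAdjoint_compression (s : ℝ) (e : H) {T : H →L[ℂ] H} (hT : IsSelfAdjoint T) :
    IsSelfAdjoint (compression s e T) := by
  have h1 : IsSelfAdjoint ((s : ℂ) • rankOne ℂ e e) :=
    IsSelfAdjoint.smul (by simp [isSelfAdjoint_iff]) (isPositive_rankOne_self e).isSelfAdjoint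
  have h2 := hT.conj_adjoint (1 - rankOne ℂ e e)
  rw [(isSelfAdjoint_one_sub_rankOne e).adjoint_eq] at h2
  exact h1.add h2

theorem isPositive_compression {s : ℝ} (hs : 0 ≤ s) (e : H) {T : H →L[ℂ] H} (hT : T.IsPositive) :
    (compression s e T).IsPositive := by
  refine .add ((isPositive_rankOne_self e).smul_of_nonneg (by exact_mod_cast hs)) ?_
  have := hT.conj_adjoint (1 - rankOne ℂ e e)
  rwa [(isSelfAdjoint_one_sub_rankOne e).adjoint_eq] at this

/-- Only the row and column of `e` change. This explicit form serves both the norm estimate and the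
Schatten-class stability. -/
theorem compression_sub (s : ℝ) {e : H} (he : ‖e‖ = 1) {T : H →L[ℂ] H} (hT : IsSelfAdjoint T) :
    compression s e T - T = rankOne ℂ ((s : ℂ) • e - T e) e + rankOne ℂ e ((s : ℂ) • e - T e) -
      inner ℂ e ((s : ℂ) • e - T e) • rankOne ℂ e e := by
  ext x
  have h1 : inner ℂ (T e) x = inner ℂ e (T x) := hT.isSymmetric e x
  have h2 : inner ℂ e e = (1 : ℂ) := by simp [inner_self_eq_norm_sq_to_K, he]
  simp only [compression, add_apply, smul_apply, comp_apply, sub_apply, one_apply_eq_self, rankOne_apply,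
    inner_smul_right, inner_smul_left, inner_sub_right, map_sub, map_smul, h1, h2,
    Complex.conj_ofReal]
  module

theorem norm_compression_sub_le (s : ℝ) {e : H} (he : ‖e‖ = 1)
    {T : H →L[ℂ] H} (hT : IsSelfAdjoint T) :
    ‖compression s e T - T‖ ≤ 3 * ‖(s : ℂ) • e - T e‖ := by
  rw [compression_sub s he hT]
  have h := norm_inner_le_norm (𝕜 := ℂ) e ((s : ℂ) • e - T e)
  rw [he, one_mul] at h
  refine (norm_sub_le _ _).trans ((add_le_add_left (norm_add_le _ _) _).trans ?_)
  simp only [norm_rankOne, norm_smul, he]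
  linarith

/-- A class of self-adjoint operators that is stable under `compression` has the
Bishop-Phelps-Bollobás point property for numerical radius. -/
theorem bppNu_of_compression_mem {A : Set (H →L[ℂ] H)} (hA : ∀ T ∈ A, IsSelfAdjoint T)
    (h : ∀ T ∈ A, ∀ e : H, ‖e‖ = 1 → ∀ s : ℝ, |s| = 1 → 0 < s * (inner ℂ e (T e)).re →
      compression s e T ∈ A) : BPBppNu A := by
  intro ε hε
  -- The bound `1` makes `⟨Te, e⟩` nonzero, so that it has a sign; `ε²/32` gives `‖s e - T e‖ ≤
  -- ε/4`, hence a total error of at most `3ε/4`.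
  refine ⟨min 1 (ε ^ 2 / 32), by positivity, fun T hT hν e he hη => ?_⟩
  have hsymm := hA T hT
  have him : ‖inner ℂ e (T e)‖ = |(inner ℂ e (T e)).re| := by
    have : ((inner ℂ e (T e)).re : ℂ) = inner ℂ e (T e) :=
      hsymm.isSymmetric.coe_re_inner_self_apply e
    rw [← this]
    simp
  rw [him] at hη
  have hpos : 0 < |(inner ℂ e (T e)).re| := by
    linarith [min_le_left 1 (ε ^ 2 / 32)]
  obtain ⟨s, hs, hst⟩ : ∃ s : ℝ, |s| = 1 ∧ s * (inner ℂ e (T e)).re = |(inner ℂ e (T e)).re| := by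
    rcases abs_cases (inner ℂ e (T e)).re with ⟨h1, _⟩ | ⟨h1, _⟩
    · exact ⟨1, by simp, by rw [h1]; simp⟩
    · exact ⟨-1, by simp, by rw [h1]; simp⟩
  refine ⟨compression s e T, h T hT e he s hs (hst ▸ hpos), numericalRadius_compression hs he hν,
    norm_inner_compression_self hs he T, ?_⟩
  have hn : ‖T‖ ≤ 1 := (numericalRadius_eq_norm hsymm.isSymmetric ▸ hν).le
  have h2 := norm_smul_sub_apply_sq_le hs he hn
  rw [hst] at h2
  have h3 : ‖(s : ℂ) • e - T e‖ ≤ ε / 4 :=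
    abs_le_of_sq_le_sq' (by linarith [min_le_right 1 (ε ^ 2 / 32)]) (by positivity) |>.2
  linarith [norm_compression_sub_le s he hsymm]

end BPB

/-! ### Norm attainment by finite-rank perturbations -/

namespace BPB

open InnerProductSpace ContinuousLinearMap

variable {H : Type*} [NormedAddCommGroup H] [InnerProductSpace ℂ H]

/-- Were `‖A‖` in the resolvent set, the Rayleigh quotients, here nonnegative, would stay a fixed
distance below `‖A‖`, which is their supremum. -/
theorem norm_mem_spectrum_of_isPositive [Nontrivial H] {A : H →L[ℂ] H} (hA : A.IsPositive) :
    (‖A‖ : ℂ) ∈ spectrum ℂ A := by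
  intro h
  obtain ⟨c, hc, hle⟩ := A.rayleighQuotient_le_of_norm_mem_resolventSet h
  have h1 : ‖A‖ ≤ ‖A‖ - c := by
    conv_lhs => rw [norm_eq_iSup_rayleighQuotient A hA.isSymmetric]
    refine ciSup_le fun x => ?_
    have h1 : 0 ≤ A.rayleighQuotient x :=
      div_nonneg (hA.re_inner_nonneg_left x) (sq_nonneg _)
    rw [abs_of_nonneg h1]
    exact hle x
  linarith

section TopEigenvector

variable [CompleteSpace H]

/-- If a compact perturbation increases the norm to that of a positive operator, this norm is
attained at an eigenvector. -/
theorem exists_eigenvector_norm_of_norm_lt [Nontrivial H] {T K : H →L[ℂ] H}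
    (hK : IsCompactOperator K) (hA : (T + K).IsPositive) (h : ‖T‖ < ‖T + K‖) :
    ∃ z : H, ‖z‖ = 1 ∧ (T + K) z = (‖T + K‖ : ℂ) • z := by
  obtain ⟨u, hu⟩ : (‖T + K‖ : ℂ) ∈ resolventSet ℂ T :=
    spectrum.mem_resolventSet_of_norm_lt (by simpa using h)
  -- With `λ = ‖T + K‖` and `u = λ - T` invertible, `λ - (T + K) = u (1 - u⁻¹K)`. As `λ` is in the
  -- spectrum, `1` must be an eigenvalue of the compact operator `u⁻¹K`.
  have hK' : IsCompactOperator ((↑u⁻¹ : H →L[ℂ] H) * K) := by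
    rw [mul_def, ContinuousLinearMap.coe_comp]
    exact hK.clm_comp _
  rcases hK'.hasEigenvalue_or_mem_resolventSet (one_ne_zero (α := ℂ)) with h1 | h1
  · obtain ⟨z, hz⟩ := h1.exists_hasEigenvector
    have hz0 := hz.2
    have h2 : ((↑u⁻¹ : H →L[ℂ] H) * K) z = z := by simpa using hz.apply_eq_smul
    have h3 : K z = (‖T + K‖ : ℂ) • z - T z := by
      have h4 : (u : H →L[ℂ] H) (((↑u⁻¹ : H →L[ℂ] H) * K) z) = K z := by
        rw [← mul_apply_eq_comp, ← mul_assoc, u.mul_inv, one_mul]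
      rw [← h4, h2, hu, sub_apply, ContinuousLinearMap.algebraMap_apply]
    have h5 : (T + K) z = (‖T + K‖ : ℂ) • z := by
      rw [add_apply, h3]; abel
    refine ⟨(‖z‖⁻¹ : ℂ) • z, by simp [norm_smul, hz0], ?_⟩
    rw [map_smul, h5, smul_comm]
  · refine absurd (norm_mem_spectrum_of_isPositive hA) ?_
    rw [spectrum.notMem_iff]
    have h2 := u.isUnit.mul (spectrum.mem_resolventSet_iff.mp h1)
    rwa [map_one, mul_sub, mul_one, ← mul_assoc, u.mul_inv, one_mul, hu, sub_sub] at h2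

end TopEigenvector

/-- Two unit vectors with large inner product are close up to a phase. -/
theorem exists_phase_norm_sub_sq_le {e z : H} (he : ‖e‖ = 1) (hz : ‖z‖ = 1) {t : ℝ}
    (h : 1 - t ≤ ‖inner ℂ e z‖ ^ 2) :
    ∃ c : ℂ, ‖c‖ = 1 ∧ ‖c • z - e‖ ^ 2 ≤ 2 * t := by
  have h1 : ‖inner ℂ e z‖ ≤ 1 := by simpa [he, hz] using norm_inner_le_norm (𝕜 := ℂ) e z
  obtain ⟨c, hc, hcz⟩ : ∃ c : ℂ, ‖c‖ = 1 ∧ c * inner ℂ e z = ‖inner ℂ e z‖ := by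
    by_cases h0 : inner ℂ e z = 0
    · exact ⟨1, by simp, by simp [h0]⟩
    · refine ⟨‖inner ℂ e z‖ / inner ℂ e z, by simp [h0], by field_simp⟩
  refine ⟨c, hc, ?_⟩
  rw [@norm_sub_sq ℂ, ← inner_conj_symm, inner_smul_right, hcz, norm_smul, hc, hz, he]
  simp only [Complex.conj_ofReal, RCLike.re_to_complex, Complex.ofReal_re]
  nlinarith [norm_nonneg (inner ℂ e z)]

theorem norm_add_smul_rankOne_of_eigenvector {A : H →L[ℂ] H} {z : H} (hz : ‖z‖ = 1)
    (hA : A z = (‖A‖ : ℂ) • z) {s : ℝ} (hs : 0 ≤ s) :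
    (A + (s : ℂ) • rankOne ℂ z z) z = ((‖A‖ + s : ℝ) : ℂ) • z ∧
      ‖A + (s : ℂ) • rankOne ℂ z z‖ = ‖A‖ + s := by
  have h1 : (A + (s : ℂ) • rankOne ℂ z z) z = ((‖A‖ + s : ℝ) : ℂ) • z := by
    simp [hA, inner_self_eq_norm_sq_to_K, hz, add_smul]
  refine ⟨h1, le_antisymm ?_ ?_⟩
  · refine (norm_add_le _ _).trans ?_
    simp [norm_smul, hz, abs_of_nonneg hs]
  · have h2 := (A + (s : ℂ) • rankOne ℂ z z).le_opNorm z
    rw [h1, norm_smul, hz, Complex.norm_real, Real.norm_of_nonneg (by positivity)] at h2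
    linarith

theorem isPositive_smul_rankOne {s : ℝ} (hs : 0 ≤ s) (z : H) :
    ((s : ℂ) • rankOne ℂ z z : H →L[ℂ] H).IsPositive :=
  (isPositive_rankOne_self z).smul_of_nonneg (by exact_mod_cast hs)

theorem finiteRankPerturbation_isPositive {δ : ℝ} (hδ : 0 ≤ δ) (x : ℕ → H) (n : ℕ) :
    (finiteRankPerturbation δ x n).IsPositive :=
  isPositive_sum _ fun k _ => by
    have := isPositive_smul_rankOne (pow_nonneg hδ k) (x k)
    rwa [Complex.ofReal_pow] at this

/-- The perturbation along a sequence that equals `e` at the first index and `z` afterwards. -/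
theorem finiteRankPerturbation_ite (δ : ℝ) (e z : H) (n : ℕ) :
    finiteRankPerturbation δ (fun k => if k ≤ 1 then e else z) (n + 1) =
      (δ : ℂ) • rankOne ℂ e e +
        ((∑ k ∈ Finset.range n, δ ^ (k + 2) : ℝ) : ℂ) • rankOne ℂ z z := by
  induction n with
  | zero => simp [finiteRankPerturbation]
  | succ n ih =>
    have h1 : finiteRankPerturbation δ (fun k => if k ≤ 1 then e else z) (n + 1 + 1) =
        finiteRankPerturbation δ (fun k => if k ≤ 1 then e else z) (n + 1) +
          ((δ : ℂ) ^ (n + 2)) • rankOne ℂ z z := by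
      rw [finiteRankPerturbation, Finset.sum_Icc_succ_top (by omega)]
      simp [finiteRankPerturbation]
    rw [h1, ih, Finset.sum_range_succ, Complex.ofReal_add, add_smul, add_assoc]
    simp

variable [CompleteSpace H]

theorem exists_perturbation_attaining {ε : ℝ} (hε : 0 < ε) (hε1 : ε < 1) {T : H →L[ℂ] H}
    (hT : T.IsPositive) (hν : numericalRadius T = 1) {e : H} (he : ‖e‖ = 1)
    (hη : 1 - ε ^ 3 / 64 < ‖inner ℂ e (T e)‖) :
    ∃ (x : ℕ → H) (xlim : H) (Tlim S : H →L[ℂ] H),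
      (∀ n, ‖x n‖ = 1) ∧
      Tendsto x atTop (𝓝 xlim) ∧
      (∀ n, (finiteRankPerturbation (ε / 4) x n).IsPositive ∧
        (T + finiteRankPerturbation (ε / 4) x n).IsPositive) ∧
      Tendsto (fun n => T + finiteRankPerturbation (ε / 4) x n) atTop (𝓝 Tlim) ∧
      Tendsto (fun n => numericalRadius (T + finiteRankPerturbation (ε / 4) x n))
        atTop (𝓝 (numericalRadius Tlim)) ∧
      Tendsto
        (fun n => ‖inner ℂ (x n) ((T + finiteRankPerturbation (ε / 4) x n) (x n))‖)
        atTop (𝓝 (numericalRadius Tlim)) ∧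
      0 < numericalRadius Tlim ∧
      Tlim = (numericalRadius Tlim : ℂ) • S ∧
      S.IsPositive ∧ numericalRadius S = 1 ∧ inner ℂ xlim (S xlim) = 1 ∧
      ‖xlim‖ = 1 ∧ ‖xlim - e‖ < ε ∧ ‖S - T‖ < ε := by
  obtain ⟨δ, hδ⟩ : ∃ δ, δ = ε / 4 := ⟨_, rfl⟩
  rw [← hδ]
  have hδ0 : 0 < δ := by linarith
  have hδ1 : δ < 1 / 4 := by linarith
  have : Nontrivial H := ⟨⟨e, 0, by rintro rfl; simp at he⟩⟩
  have hnorm : ‖T‖ = 1 := numericalRadius_eq_norm hT.isSymmetric ▸ hν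
  obtain ⟨a, ha⟩ : ∃ a : ℝ, inner ℂ e (T e) = a :=
    ⟨_, (hT.isSymmetric.coe_re_inner_self_apply e).symm⟩
  have ha0 : 0 ≤ a := by
    have := hT.inner_nonneg_right e
    rw [ha] at this
    exact_mod_cast this
  rw [ha, Complex.norm_real, Real.norm_of_nonneg ha0] at hη
  set A : H →L[ℂ] H := T + (δ : ℂ) • rankOne ℂ e e with hAdef
  have hApos : A.IsPositive := hT.add (isPositive_smul_rankOne hδ0.le e)
  have hA1 : a + δ ≤ ‖A‖ := by
    have h1 : inner ℂ e (A e) = ((a + δ : ℝ) : ℂ) := by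
      simp [hAdef, ha, inner_self_eq_norm_sq_to_K, he]
    have h2 := norm_inner_le_numericalRadius A e
    rw [h1, Complex.norm_real, Real.norm_of_nonneg (by positivity), he,
      numericalRadius_eq_norm hApos.isSymmetric] at h2
    linarith
  have hcube : ε ^ 3 / 64 = δ * (ε ^ 2 / 16) := by rw [hδ]; ring
  -- Since `a > 1 - δ ε²/16`, the bound `a + δ` exceeds `1`.
  have hA2 : ‖T‖ < ‖A‖ := by nlinarith
  obtain ⟨z₀, hz₀, hAz₀⟩ := exists_eigenvector_norm_of_norm_lt
    ((isCompactOperator_rankOne e e).smul (δ : ℂ)) hApos hA2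
  rw [← hAdef] at hAz₀
  -- At `z₀`, `T` contributes at most `1` to `‖A‖ ≥ a + δ`, so the rank-one term must supply almost
  -- all of `δ`. The factor `δ` in `η = δ ε²/16` cancels here.
  have hoverlap : 1 - ε ^ 2 / 16 ≤ ‖inner ℂ e z₀‖ ^ 2 := by
    have h1 : (‖A‖ : ℂ) = inner ℂ z₀ (T z₀) + ((δ * ‖inner ℂ e z₀‖ ^ 2 : ℝ) : ℂ) := by
      have h2 : inner ℂ z₀ (A z₀) = (‖A‖ : ℂ) := by
        rw [hAz₀, inner_smul_right, inner_self_eq_norm_sq_to_K, hz₀]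
        simp
      rw [← h2, hAdef, add_apply, inner_add_right, smul_apply, rankOne_apply, inner_smul_right,
        inner_smul_right, ← inner_conj_symm z₀ e, Complex.mul_conj, Complex.normSq_eq_norm_sq]
      push_cast
      rfl
    have h3 : ‖inner ℂ z₀ (T z₀)‖ ≤ 1 := by
      simpa [hz₀, hν] using norm_inner_le_numericalRadius T z₀
    have h4 : ‖A‖ ≤ 1 + δ * ‖inner ℂ e z₀‖ ^ 2 := by
      have h5 := congrArg norm h1
      rw [Complex.norm_real, norm_norm] at h5
      rw [h5]
      refine (norm_add_le _ _).trans ?_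
      rw [Complex.norm_real, Real.norm_of_nonneg (by positivity)]
      linarith
    have h6 : δ * (1 - ε ^ 2 / 16) ≤ δ * ‖inner ℂ e z₀‖ ^ 2 := by nlinarith
    exact le_of_mul_le_mul_left h6 hδ0
  obtain ⟨c, hc, hcz⟩ := exists_phase_norm_sub_sq_le he hz₀ hoverlap
  obtain ⟨z, hzdef⟩ : ∃ z, z = c • z₀ := ⟨_, rfl⟩
  rw [← hzdef] at hcz
  have hz : ‖z‖ = 1 := by rw [hzdef, norm_smul, hc, hz₀, one_mul]
  have hAz : A z = (‖A‖ : ℂ) • z := by rw [hzdef, map_smul, hAz₀, smul_comm]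
  -- The sums start at `k = 1`, so `e` enters exactly once, with weight `δ`; the value at `0` need
  -- only be a unit vector.
  set x : ℕ → H := fun k => if k ≤ 1 then e else z with hxdef
  set s : ℕ → ℝ := fun n => ∑ k ∈ Finset.range n, δ ^ (k + 2) with hsdef
  -- The total weight `δ² + δ³ + ⋯` placed on `z`.
  set s' : ℝ := δ ^ 2 * (1 - δ)⁻¹ with hs'def
  have hs0 (n) : 0 ≤ s n := Finset.sum_nonneg fun k _ => by positivity
  have hslim : Tendsto s atTop (𝓝 s') := by
    have h := ((hasSum_geometric_of_lt_one hδ0.le (by linarith)).mul_left (δ ^ 2)).tendsto_sum_nat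
    refine h.congr fun n => Finset.sum_congr rfl fun k _ => by ring
  have hs'0 : 0 ≤ s' := by have : 0 < 1 - δ := by linarith
                           positivity
  have hs'le : δ + s' < 2 / 5 * ε := by
    have : δ + s' = δ / (1 - δ) := by
      have : 1 - δ ≠ 0 := by linarith
      rw [hs'def]; field_simp; ring
    rw [this, div_lt_iff₀ (by linarith)]
    nlinarith
  have hTn (n : ℕ) : T + finiteRankPerturbation δ x (n + 1) = A + (s n : ℂ) • rankOne ℂ z z := by
    rw [hxdef, finiteRankPerturbation_ite, ← add_assoc]
  have hxev : ∀ n, x (n + 2) = z := fun n => by simp [hxdef]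
  set B : H →L[ℂ] H := A + (s' : ℂ) • rankOne ℂ z z with hBdef
  have hBpos : B.IsPositive := hApos.add (isPositive_smul_rankOne hs'0 z)
  obtain ⟨hBz, hBnorm⟩ := norm_add_smul_rankOne_of_eigenvector hz hAz hs'0
  rw [← hBdef] at hBz hBnorm
  have hνB : numericalRadius B = ‖A‖ + s' :=
    (numericalRadius_eq_norm hBpos.isSymmetric).trans hBnorm
  have hρ : 0 < ‖A‖ + s' := by linarith
  have hρ' : ((‖A‖ + s' : ℝ) : ℂ) ≠ 0 := by exact_mod_cast hρ.ne'
  have hAle : ‖A‖ ≤ 1 + δ := by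
    refine (norm_add_le _ _).trans ?_
    simp [hnorm, norm_smul, he, abs_of_pos hδ0]
  have hSpos : (((‖A‖ + s' : ℝ) : ℂ)⁻¹ • B).IsPositive := by
    rw [← Complex.ofReal_inv]
    exact hBpos.smul_of_nonneg (by exact_mod_cast (inv_pos.mpr hρ).le)
  refine ⟨x, z, B, ((‖A‖ + s' : ℝ) : ℂ)⁻¹ • B, fun n => ?_, ?_, fun n => ?_, ?_, ?_, ?_,
    hνB ▸ hρ, ?_, hSpos, ?_, ?_, hz, ?_, ?_⟩
  · by_cases h : n ≤ 1 <;> simp [hxdef, h, he, hz]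
  · rw [← tendsto_add_atTop_iff_nat 2]
    simp [hxev]
  · exact ⟨finiteRankPerturbation_isPositive hδ0.le x n,
      hT.add (finiteRankPerturbation_isPositive hδ0.le x n)⟩
  · rw [← tendsto_add_atTop_iff_nat 1]
    simp only [hTn]
    exact tendsto_const_nhds.add
      (((Complex.continuous_ofReal.tendsto _).comp hslim).smul tendsto_const_nhds)
  · rw [← tendsto_add_atTop_iff_nat 1, hνB]
    have h (n) : numericalRadius (A + (s n : ℂ) • rankOne ℂ z z) = ‖A‖ + s n :=
      (numericalRadius_eq_norm (hApos.add (isPositive_smul_rankOne (hs0 n) z)).isSymmetric).trans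
        (norm_add_smul_rankOne_of_eigenvector hz hAz (hs0 n)).2
    simp only [hTn, h]
    exact tendsto_const_nhds.add hslim
  · rw [← tendsto_add_atTop_iff_nat 2, hνB]
    have h (n) : ‖inner ℂ z ((A + (s n : ℂ) • rankOne ℂ z z) z)‖ = ‖A‖ + s n := by
      rw [(norm_add_smul_rankOne_of_eigenvector hz hAz (hs0 n)).1, inner_smul_right,
        inner_self_eq_norm_sq_to_K, hz, norm_mul, Complex.norm_real,
        Real.norm_of_nonneg (add_nonneg (norm_nonneg _) (hs0 n))]
      simp
    have h' (n) : T + finiteRankPerturbation δ x (n + 2) =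
        A + (s (n + 1) : ℂ) • rankOne ℂ z z := hTn (n + 1)
    simp only [h', hxev, h]
    exact tendsto_const_nhds.add ((tendsto_add_atTop_iff_nat 1).mpr hslim)
  · rw [hνB, smul_inv_smul₀ hρ']
  · rw [numericalRadius_eq_norm hSpos.isSymmetric, norm_smul, hBnorm, norm_inv, Complex.norm_real,
      Real.norm_of_nonneg hρ.le, inv_mul_cancel₀ hρ.ne']
  · rw [smul_apply, hBz, inv_smul_smul₀ hρ', inner_self_eq_norm_sq_to_K, hz]
    simp
  · refine lt_of_pow_lt_pow_left₀ 2 hε.le (hcz.trans_lt ?_)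
    nlinarith [sq_pos_of_pos hε]
  -- With `ρ = ‖A‖ + s'` and `S = ρ⁻¹B`, `S - T = (1 - ρ)S + (B - T)`. Both terms have norm at most
  -- `δ + s' < 2ε/5`.
  · have h1 : ((‖A‖ + s' : ℝ) : ℂ)⁻¹ • B - T =
        (1 - ((‖A‖ + s' : ℝ) : ℂ)) • (((‖A‖ + s' : ℝ) : ℂ)⁻¹ • B) +
          ((δ : ℂ) • rankOne ℂ e e + (s' : ℂ) • rankOne ℂ z z) := by
      rw [sub_smul, smul_inv_smul₀ hρ', hBdef, hAdef]
      module
    have h2 : ‖((‖A‖ + s' : ℝ) : ℂ)⁻¹ • B‖ = 1 := by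
      rw [norm_smul, hBnorm, norm_inv, Complex.norm_real,
        Real.norm_of_nonneg hρ.le, inv_mul_cancel₀ hρ.ne']
    have h3 : ‖(1 : ℂ) - ((‖A‖ + s' : ℝ) : ℂ)‖ ≤ δ + s' := by
      rw [← Complex.ofReal_one, ← Complex.ofReal_sub, Complex.norm_real, Real.norm_eq_abs, abs_le]
      constructor <;> linarith
    have h4 : ‖(δ : ℂ) • rankOne ℂ e e + (s' : ℂ) • rankOne ℂ z z‖ ≤ δ + s' := by
      refine (norm_add_le _ _).trans ?_
      simp [norm_smul, he, hz, abs_of_pos hδ0, abs_of_nonneg hs'0]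
    rw [h1]
    refine (norm_add_le _ _).trans_lt ?_
    rw [norm_smul, h2]
    linarith

end BPB

/-! ### Schatten classes through diagonals along orthonormal families -/

namespace BPB

open InnerProductSpace ContinuousLinearMap Module.End

/-- Jensen's inequality for sub-probability weights on a discrete space. -/
theorem rpow_tsum_mul_le {ι : Type*} {w : ι → ℝ≥0∞} (hw : ∑' i, w i ≤ 1) (f : ι → ℝ≥0∞) {p : ℝ}
    (hp : 1 ≤ p) : (∑' i, w i * f i) ^ p ≤ ∑' i, w i * f i ^ p := by
  have hp0 : 0 < p := by linarith
  rw [← ENNReal.le_rpow_inv_iff hp0, ENNReal.tsum_eq_iSup_sum]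
  refine iSup_le fun s => (ENNReal.inner_le_weight_mul_Lp_of_nonneg s hp w f).trans ?_
  calc (∑ i ∈ s, w i) ^ (1 - p⁻¹) * (∑ i ∈ s, w i * f i ^ p) ^ p⁻¹
      ≤ 1 ^ (1 - p⁻¹) * (∑' i, w i * f i ^ p) ^ p⁻¹ := by
        gcongr
        · exact sub_nonneg.mpr (inv_le_one_of_one_le₀ hp)
        · exact (ENNReal.sum_le_tsum s).trans hw
        · exact ENNReal.sum_le_tsum s
    _ = _ := by simp

theorem memℓp_ofReal_iff {ι E : Type*} [NormedAddCommGroup E] {f : ι → E} {p : ℝ} (hp : 0 < p) :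
    Memℓp f (ENNReal.ofReal p) ↔ ∑' i, ‖f i‖ₑ ^ p < ∞ := by
  have h : (ENNReal.ofReal p).toReal = p := ENNReal.toReal_ofReal hp.le
  rw [memℓp_gen_iff (h.symm ▸ hp), h, lt_top_iff_ne_top]
  have h1 : (fun i => ‖f i‖ₑ ^ p) = fun i => ((‖f i‖₊ ^ p : NNReal) : ℝ≥0∞) := by
    ext i
    rw [ENNReal.coe_rpow_of_nonneg _ hp.le]
    rfl
  rw [h1, ENNReal.tsum_coe_ne_top_iff_summable, ← NNReal.summable_coe]
  simp

variable {H : Type*} [NormedAddCommGroup H] [InnerProductSpace ℂ H]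

theorem tsum_enorm_inner_sq_le {ι : Type*} {v : ι → H} (hv : Orthonormal ℂ v) (x : H) :
    ∑' i, ‖inner ℂ (v i) x‖ₑ ^ 2 ≤ ‖x‖ₑ ^ 2 := by
  have h1 (y : ℂ) : ‖y‖ₑ ^ 2 = ENNReal.ofReal (‖y‖ ^ 2) := by
    rw [ENNReal.ofReal_pow (norm_nonneg _), ofReal_norm]
  have h2 : ‖x‖ₑ ^ 2 = ENNReal.ofReal (‖x‖ ^ 2) := by
    rw [ENNReal.ofReal_pow (norm_nonneg _), ofReal_norm]
  simp only [h1, h2]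
  rw [← ENNReal.ofReal_tsum_of_nonneg (fun _ => sq_nonneg _) (hv.inner_products_summable x)]
  exact ENNReal.ofReal_le_ofReal (hv.tsum_inner_products_le x)

/-- Each diagonal entry is a product of coefficients of `a` and `b`, both square-summable by Bessel.
-/
theorem memℓp_inner_rankOne {ι : Type*} {f : ι → H} (hf : Orthonormal ℂ f) (a b : H) :
    Memℓp (fun j => inner ℂ (f j) (rankOne ℂ a b (f j))) 1 := by
  refine memℓp_gen ?_
  simp only [ENNReal.toReal_one, Real.rpow_one]
  refine .of_nonneg_of_le (fun _ => norm_nonneg _) (fun j => ?_)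
    ((hf.inner_products_summable a).add (hf.inner_products_summable b))
  rw [rankOne_apply, inner_smul_right, norm_mul, norm_inner_symm b]
  nlinarith [sq_nonneg (‖inner ℂ (f j) b‖ - ‖inner ℂ (f j) a‖), sq_nonneg ‖inner ℂ (f j) b‖,
    sq_nonneg ‖inner ℂ (f j) a‖]

theorem tsum_eigenMultiplicity_mul (A : H →L[ℂ] H) (p : ℝ) :
    ∑' a : (Σ μ : {μ : ℝ // 0 < μ}, Fin (eigenMultiplicity A μ)), ENNReal.ofReal a.1 ^ p =
      ∑' μ : {μ : ℝ // 0 < μ}, (eigenMultiplicity A μ : ℝ≥0∞) * ENNReal.ofReal (μ : ℝ) ^ p := by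
  rw [ENNReal.tsum_sigma (fun (μ : {μ : ℝ // 0 < μ}) (_ : Fin (eigenMultiplicity A μ)) =>
    ENNReal.ofReal (μ : ℝ) ^ p)]
  simp

variable [CompleteSpace H]

/-- Quadratic form of a self-adjoint operator that vanishes off an orthonormal family of
eigenvectors. -/
theorem hasSum_inner_of_eigenvectors {ι : Type*} {A : H →L[ℂ] H} (hA : A.IsSymmetric)
    {b : ι → H} (hb : Orthonormal ℂ b) {c : ι → ℝ} (hc : ∀ i, A (b i) = (c i : ℂ) • b i)
    (h0 : ∀ v, (∀ i, inner ℂ (b i) v = 0) → A v = 0) (x : H) :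
    HasSum (fun i => ((‖inner ℂ (b i) x‖ ^ 2 * c i : ℝ) : ℂ)) (inner ℂ x (A x)) := by
  -- Parseval in a Hilbert basis extending `b`: the added vectors are orthogonal to `b`, so `A`
  -- kills them and only the terms of `b` survive.
  obtain ⟨w, B, hw, hB⟩ := hb.toSubtypeRange.exists_hilbertBasis_extension
  have h1 := B.hasSum_inner_mul_inner x (A x)
  let g : ι → w := fun i => ⟨b i, hw ⟨i, rfl⟩⟩
  have hg : Function.Injective g := fun i j hij =>
    hb.linearIndependent.injective (congrArg Subtype.val hij)
  rw [← hg.hasSum_iff] at h1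
  · have hterm : ((fun i => inner ℂ x (B i) * inner ℂ (B i) (A x)) ∘ g) =
        fun i => ((‖inner ℂ (b i) x‖ ^ 2 * c i : ℝ) : ℂ) := by
      ext i
      have h2 : inner ℂ (b i) (A x) = c i * inner ℂ (b i) x := by
        have h3 : inner ℂ (A (b i)) x = inner ℂ (b i) (A x) := hA (b i) x
        rw [← h3, hc, inner_smul_left, Complex.conj_ofReal]
      have h4 : B (g i) = b i := by rw [hB]
      rw [Function.comp_apply, h4, h2, ← inner_conj_symm x (b i), mul_left_comm,
        ← Complex.normSq_eq_conj_mul_self, Complex.normSq_eq_norm_sq]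
      push_cast
      ring
    rw [hterm] at h1
    exact h1
  · intro y hy
    have h2 : A (B y) = 0 := by
      refine h0 _ fun i => ?_
      have h3 : g i ≠ y := fun h => hy ⟨i, h⟩
      have h4 := B.orthonormal.2 h3
      simpa [hB, g] using h4
    have h3 : inner ℂ (A (B y)) x = inner ℂ (B y) (A x) := hA (B y) x
    rw [← h3, h2, inner_zero_left, mul_zero]

theorem abs_apply_abs_apply {T : H →L[ℂ] H} (hT : IsSelfAdjoint T) (v : H) :
    CFC.abs T (CFC.abs T v) = T (T v) := by
  have := congrArg (fun S : H →L[ℂ] H => S v) (CFC.abs_mul_abs T)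
  simpa [hT.star_eq] using this

theorem isPositive_abs (T : H →L[ℂ] H) : (CFC.abs T).IsPositive :=
  (nonneg_iff_isPositive _).mp (CFC.abs_nonneg T)

/-- Both `|T| - T` and `|T| + T` are positive, being twice the negative and positive parts of `T`.
-/
theorem norm_inner_le_re_inner_abs {T : H →L[ℂ] H} (hT : IsSelfAdjoint T) (x : H) :
    ‖inner ℂ x (T x)‖ ≤ (inner ℂ x (CFC.abs T x)).re := by
  have h1 : (CFC.abs T - T).IsPositive := by
    rw [← nonneg_iff_isPositive, CFC.abs_sub_self T hT]
    exact nsmul_nonneg (CFC.negPart_nonneg T) 2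
  have h2 : (CFC.abs T + T).IsPositive := by
    rw [← nonneg_iff_isPositive, CFC.abs_add_self T hT]
    exact nsmul_nonneg (CFC.posPart_nonneg T) 2
  have h3 := h1.re_inner_nonneg_right x
  have h4 := h2.re_inner_nonneg_right x
  have h5 : ((inner ℂ x (T x)).re : ℂ) = inner ℂ x (T x) :=
    hT.isSymmetric.coe_re_inner_self_apply x
  rw [← h5, Complex.norm_real, Real.norm_eq_abs, abs_le]
  simp only [sub_apply, add_apply, inner_sub_right, inner_add_right, map_sub, map_add,
    RCLike.re_to_complex] at h3 h4
  constructor <;> linarith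

theorem abs_apply_eq_of_apply_eq {T : H →L[ℂ] H} (hT : IsSelfAdjoint T) {c : ℝ} {v : H}
    (hv : T v = (c : ℂ) • v) : CFC.abs T v = ((|c| : ℝ) : ℂ) • v := by
  by_cases hc : c = 0
  · have h1 : ‖CFC.abs T v‖ ^ 2 = 0 := by
      rw [← inner_self_eq_norm_sq (𝕜 := ℂ), (isPositive_abs T).inner_left_eq_inner_right,
        abs_apply_abs_apply hT, hv, hc]
      simp
    simpa [hc] using h1
  have hc' : 0 < |c| := abs_pos.mpr hc
  -- From `|T|² = T²`, `u` satisfies `|T|u = -|c|u`, which positivity of `|T|` allows only for `u =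
  -- 0`.
  set u : H := CFC.abs T v - ((|c| : ℝ) : ℂ) • v with hu
  have h1 : CFC.abs T u = -((|c| : ℝ) : ℂ) • u := by
    have h2 : ((|c| : ℝ) : ℂ) * ((|c| : ℝ) : ℂ) = (c : ℂ) * c := by
      rw [← Complex.ofReal_mul, abs_mul_abs_self, Complex.ofReal_mul]
    rw [hu, map_sub, map_smul, abs_apply_abs_apply hT, hv, map_smul, hv, smul_sub, smul_smul,
      smul_smul, neg_mul, h2]
    module
  have h2 := (isPositive_abs T).re_inner_nonneg_right u
  rw [h1, inner_smul_right, inner_self_eq_norm_sq_to_K, ← Complex.ofReal_neg] at h2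
  have h3 : 0 ≤ -|c| * ‖u‖ ^ 2 := by
    rw [RCLike.re_to_complex, Complex.re_ofReal_mul] at h2
    convert h2
    norm_cast
  have h4 : ‖u‖ ^ 2 = 0 := by nlinarith [sq_nonneg ‖u‖]
  have h5 : u = 0 := by simpa using h4
  exact sub_eq_zero.mp h5

theorem finiteDimensional_eigenspace_abs {T : H →L[ℂ] H} (hT : IsSelfAdjoint T)
    (hc : IsCompactOperator T) {μ : ℝ} (hμ : 0 < μ) :
    FiniteDimensional ℂ (eigenspace (CFC.abs T).toLinearMap (μ : ℂ)) := by
  have h1 : IsCompactOperator (T ∘L T) := by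
    rw [ContinuousLinearMap.coe_comp]
    exact hc.comp_clm T
  have h2 := finite_dimensional_eigenspace h1 ((μ : ℂ) * μ) (by simp [hμ.ne'])
  refine Submodule.finiteDimensional_of_le (S₂ := eigenspace (T ∘L T).toLinearMap ((μ : ℂ) * μ))
    fun v hv => ?_
  have hv' : CFC.abs T v = (μ : ℂ) • v := mem_eigenspace_iff.mp hv
  refine mem_eigenspace_iff.mpr ?_
  change T (T v) = _
  rw [← abs_apply_abs_apply hT, hv', map_smul, hv', smul_smul]

/-- Eigenvectors of `T` for `c ≠ 0` are eigenvectors of `|T|` for `|c|`, so `T v` is orthogonal to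
every eigenspace of `T` and vanishes by the spectral theorem. -/
theorem abs_apply_eq_zero {T : H →L[ℂ] H} (hT : IsSelfAdjoint T) (hc : IsCompactOperator T) {v : H}
    (hv : ∀ μ : ℝ, 0 < μ → ∀ y, CFC.abs T y = (μ : ℂ) • y → inner ℂ y v = 0) :
    CFC.abs T v = 0 := by
  have h1 : T v ∈ (⨆ μ, eigenspace (T : H →ₗ[ℂ] H) μ)ᗮ := by
    rw [← Submodule.iInf_orthogonal, Submodule.mem_iInf]
    intro μ y hy
    have hy' : T y = μ • y := mem_eigenspace_iff.mp hy
    have h2 : inner ℂ (T y) v = inner ℂ y (T v) := hT.isSymmetric y v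
    by_cases hy0 : y = 0
    · simp [hy0]
    obtain ⟨c, rfl⟩ := Complex.conj_eq_iff_real.mp
      (hT.isSymmetric.conj_eigenvalue_eq_self (hasEigenvalue_of_hasEigenvector ⟨hy, hy0⟩))
    rw [← h2, hy', inner_smul_left]
    by_cases hc0 : c = 0
    · simp [hc0]
    rw [hv |c| (abs_pos.mpr hc0) y (abs_apply_eq_of_apply_eq hT hy'), mul_zero]
  rw [orthogonalComplement_iSup_eigenspaces_eq_bot hc hT.isSymmetric, Submodule.mem_bot] at h1
  simpa using abs_apply_eq_of_apply_eq hT (c := 0) (v := v) (by simpa using h1)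

/-- An orthonormal family of eigenvectors of a compact self-adjoint operator, indexed by the
nonzero eigenvalues of its absolute value with multiplicity. -/
theorem exists_orthonormal_eigenvectors {T : H →L[ℂ] H} (hT : IsSelfAdjoint T)
    (hc : IsCompactOperator T) :
    ∃ b : (Σ μ : {μ : ℝ // 0 < μ}, Fin (eigenMultiplicity (CFC.abs T) μ)) → H,
      Orthonormal ℂ b ∧ (∀ a, CFC.abs T (b a) = ((a.1 : ℝ) : ℂ) • b a) ∧
      (∀ a, ‖inner ℂ (b a) (T (b a))‖ = a.1) ∧
      ∀ v, (∀ a, inner ℂ (b a) v = 0) → CFC.abs T v = 0 := by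
  -- An arbitrary basis of an eigenspace of `|T|` need not diagonalise `T`. Since `T` commutes with
  -- `|T|`, it restricts to the eigenspace, and a basis of eigenvectors of this restriction gives
  -- diagonal entries `±μ`.
  have hfin (μ : {μ : ℝ // 0 < μ}) := finiteDimensional_eigenspace_abs hT hc μ.2
  have hinv (μ : {μ : ℝ // 0 < μ}) : ∀ v ∈ eigenspace (CFC.abs T).toLinearMap ((μ : ℝ) : ℂ),
      (T : H →ₗ[ℂ] H) v ∈ eigenspace (CFC.abs T).toLinearMap ((μ : ℝ) : ℂ) := by
    intro v hv
    have hv' : CFC.abs T v = ((μ : ℝ) : ℂ) • v := mem_eigenspace_iff.mp hv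
    refine mem_eigenspace_iff.mpr ?_
    have h1 := congrArg (fun S : H →L[ℂ] H => S v) (CFC.commute_abs_self T hT.isStarNormal).eq
    have h2 : CFC.abs T (T v) = T (CFC.abs T v) := h1
    change CFC.abs T (T v) = _
    rw [h2, hv', map_smul]
    rfl
  have hsymm (μ : {μ : ℝ // 0 < μ}) := hT.isSymmetric.restrict_invariant (hinv μ)
  let β (μ : {μ : ℝ // 0 < μ}) :=
    (hsymm μ).eigenvectorBasis (n := eigenMultiplicity (CFC.abs T) μ) rfl
  have hβ : ∀ μ i, CFC.abs T (β μ i : H) = ((μ : ℝ) : ℂ) • (β μ i : H) := fun μ i =>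
    mem_eigenspace_iff.mp (β μ i).2
  refine ⟨fun a => (β a.1 a.2 : H), ?_, fun a => hβ _ _, ?_, ?_⟩
  · exact ((isPositive_abs T).isSymmetric.orthogonalFamily_eigenspaces.comp
      (f := fun μ : {μ : ℝ // 0 < μ} => ((μ : ℝ) : ℂ))
      (Complex.ofReal_injective.comp Subtype.val_injective)).orthonormal_sigma_orthonormal
      fun μ => (β μ).orthonormal
  · rintro ⟨μ, i⟩
    have h1 : T (β μ i : H) = ((hsymm μ).eigenvalues rfl i : ℂ) • (β μ i : H) :=
      congrArg Subtype.val ((hsymm μ).apply_eigenvectorBasis rfl i)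
    have h2 : ‖(β μ i : H)‖ = 1 := (β μ).orthonormal.1 i
    have h3 := congrArg (inner ℂ (β μ i : H)) ((hβ μ i).symm.trans (abs_apply_eq_of_apply_eq hT h1))
    simp only [inner_smul_right, inner_self_eq_norm_sq_to_K, h2] at h3
    change ‖inner ℂ (β μ i : H) (T (β μ i : H))‖ = μ
    rw [h1, inner_smul_right, inner_self_eq_norm_sq_to_K, h2, norm_mul, Complex.norm_real,
      Real.norm_eq_abs]
    simp only [RCLike.ofReal_one, one_pow, mul_one, norm_one] at h3 ⊢
    exact_mod_cast h3.symm
  · intro v hv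
    refine abs_apply_eq_zero hT hc fun μ hμ y hy => ?_
    let y' : eigenspace (CFC.abs T).toLinearMap (μ : ℂ) := ⟨y, mem_eigenspace_iff.mpr hy⟩
    have h1 : y = ∑ i, inner ℂ (β ⟨μ, hμ⟩ i) y' • (β ⟨μ, hμ⟩ i : H) := by
      have := congrArg Subtype.val ((β ⟨μ, hμ⟩).sum_repr' y')
      simpa using this.symm
    rw [h1, sum_inner]
    refine Finset.sum_eq_zero fun i _ => ?_
    rw [inner_smul_left, hv ⟨⟨μ, hμ⟩, i⟩, mul_zero]

/-- The numbers `|⟨b a, f j⟩|²` have row and column sums at most `1` by Bessel. Jensen uses one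
bound, and the other applies after exchanging the sums. -/
theorem tsum_enorm_inner_rpow_le {T : H →L[ℂ] H} (hT : IsSelfAdjoint T)
    (hc : IsCompactOperator T) {p : ℝ} (hp : 1 ≤ p) {ι : Type*} {f : ι → H}
    (hf : Orthonormal ℂ f) : ∑' j, ‖inner ℂ (f j) (T (f j))‖ₑ ^ p ≤
      ∑' μ : {μ : ℝ // 0 < μ},
        (eigenMultiplicity (CFC.abs T) μ : ℝ≥0∞) * ENNReal.ofReal (μ : ℝ) ^ p := by
  obtain ⟨b, hb, hAb, -, h0⟩ := exists_orthonormal_eigenvectors hT hc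
  have h1 (x : H) : ‖inner ℂ x (T x)‖ₑ ≤ ∑' a, ‖inner ℂ (b a) x‖ₑ ^ 2 * ENNReal.ofReal a.1 := by
    have h2 := hasSum_inner_of_eigenvectors (isPositive_abs T).isSymmetric hb hAb h0 x
    have h3 := Complex.hasSum_re h2
    simp only [Complex.ofReal_re] at h3
    calc ‖inner ℂ x (T x)‖ₑ = ENNReal.ofReal ‖inner ℂ x (T x)‖ := (ofReal_norm _).symm
      _ ≤ ENNReal.ofReal (inner ℂ x (CFC.abs T x)).re :=
        ENNReal.ofReal_le_ofReal (norm_inner_le_re_inner_abs hT x)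
      _ = ∑' a, ENNReal.ofReal (‖inner ℂ (b a) x‖ ^ 2 * a.1) := by
        rw [← h3.tsum_eq, ENNReal.ofReal_tsum_of_nonneg
          (fun a => mul_nonneg (sq_nonneg _) a.1.2.le) h3.summable]
      _ = _ := by
        refine tsum_congr fun a => ?_
        rw [ENNReal.ofReal_mul (sq_nonneg _), ENNReal.ofReal_pow (norm_nonneg _),
          ofReal_norm]
  rw [← tsum_eigenMultiplicity_mul]
  calc ∑' j, ‖inner ℂ (f j) (T (f j))‖ₑ ^ p
      ≤ ∑' j, ∑' a, ‖inner ℂ (b a) (f j)‖ₑ ^ 2 * ENNReal.ofReal a.1 ^ p := by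
        refine ENNReal.tsum_le_tsum fun j => ?_
        refine (ENNReal.rpow_le_rpow (h1 (f j)) (by linarith)).trans (rpow_tsum_mul_le ?_ _ hp)
        refine (tsum_enorm_inner_sq_le hb (f j)).trans ?_
        simp [enorm_eq_nnnorm, nnnorm, hf.1 j]
    _ = ∑' a, (∑' j, ‖inner ℂ (f j) (b a)‖ₑ ^ 2) * ENNReal.ofReal a.1 ^ p := by
        rw [ENNReal.tsum_comm]
        refine tsum_congr fun a => ?_
        rw [← ENNReal.tsum_mul_right]
        refine tsum_congr fun j => ?_
        rw [← ofReal_norm, norm_inner_symm, ofReal_norm]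
    _ ≤ _ := by
        refine ENNReal.tsum_le_tsum fun a => mul_le_of_le_one_left (by positivity) ?_
        refine (tsum_enorm_inner_sq_le hf (b a)).trans ?_
        simp [enorm_eq_nnnorm, nnnorm, hb.1 a]

/-- A compact self-adjoint operator has finite Schatten norm if and only if its diagonal with
respect to every orthonormal family is `p`-summable. -/
theorem schattenNorm_lt_top_iff {T : H →L[ℂ] H} (hT : IsSelfAdjoint T)
    (hc : IsCompactOperator T) {p : ℝ} (hp : 1 ≤ p) :
    schattenNorm p T < ∞ ↔ ∀ {ι : Type} {f : ι → H}, Orthonormal ℂ f →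
      Memℓp (fun j => inner ℂ (f j) (T (f j))) (ENNReal.ofReal p) := by
  have hp0 : 0 < p := by linarith
  rw [schattenNorm, ENNReal.rpow_lt_top_iff_of_pos (by positivity)]
  constructor
  · intro h ι f hf
    rw [memℓp_ofReal_iff hp0]
    exact (tsum_enorm_inner_rpow_le hT hc hp hf).trans_lt h
  · intro h
    -- This family is indexed by real numbers and finite ordinals, so index sets in `Type` suffice
    -- whatever the universe of `H`.
    obtain ⟨b, hb, -, hb', -⟩ := exists_orthonormal_eigenvectors hT hc
    have h1 := h hb
    rw [memℓp_ofReal_iff hp0] at h1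
    rw [← tsum_eigenMultiplicity_mul]
    refine lt_of_le_of_lt (le_of_eq (tsum_congr fun a => ?_)) h1
    rw [← ofReal_norm, hb']

theorem compression_mem_schattenClass {T : H →L[ℂ] H} (hT : IsSelfAdjoint T) {p : ℝ} (hp : 1 ≤ p)
    (h : T ∈ schattenClass H p) (s : ℝ) {e : H} (he : ‖e‖ = 1) :
    compression s e T ∈ schattenClass H p := by
  have hc := isCompactOperator_compression s e h.1
  refine ⟨hc, (schattenNorm_lt_top_iff (isSelfAdjoint_compression s e hT) hc hp).mpr ?_⟩
  intro ι f hf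
  have h1 := (schattenNorm_lt_top_iff hT h.1 hp).mp h.2 hf
  -- Rank-one diagonals are in `ℓ¹`, hence in `ℓᵖ` because `p ≥ 1`.
  have h2 (a b : H) := (memℓp_inner_rankOne hf a b).of_exponent_ge
    (p := ENNReal.ofReal p) (by simpa using ENNReal.ofReal_le_ofReal hp)
  have h4 := sub_eq_iff_eq_add'.mp (compression_sub s he hT)
  generalize (s : ℂ) • e - T e = u at h4
  have h3 := h1.add (((h2 u e).add (h2 e u)).sub ((h2 e e).const_smul (inner ℂ e u)))
  convert h3 using 2 with j
  rw [h4]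
  simp only [add_apply, sub_apply, smul_apply, inner_add_right, inner_sub_right, inner_smul_right,
    Pi.add_apply, Pi.sub_apply, Pi.smul_apply, smul_eq_mul]

end BPB

/-! ### Stability of each class and conclusion -/

namespace BPB

/-- For positive operators this rules out the sign `-1`, so that `sP + QTQ` is again positive. -/
theorem nonneg_of_mul_re_inner_pos {H : Type*} [NormedAddCommGroup H] [InnerProductSpace ℂ H]
    {T : H →L[ℂ] H} (hT : T.IsPositive) {s : ℝ} {e : H}
    (h : 0 < s * (inner ℂ e (T e)).re) : 0 ≤ s :=
  (pos_of_mul_pos_left h (hT.re_inner_nonneg_right e)).le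

end BPB

theorem proposition4p2 (H : Type*) [NormedAddCommGroup H] [InnerProductSpace ℂ H]
    [CompleteSpace H] :
    -- positive operators
    BPB.BPBppNu {T : H →L[ℂ] H | T.IsPositive} ∧
    -- positive Schatten-von Neumann operators: for each exponent, and for all exponents together
    (∀ p : ℝ, 1 ≤ p → BPB.BPBppNu {T : H →L[ℂ] H | T.IsPositive ∧ T ∈ BPB.schattenClass H p}) ∧
    BPB.BPBppNu {T : H →L[ℂ] H | T.IsPositive ∧ ∃ p : ℝ, 1 ≤ p ∧ T ∈ BPB.schattenClass H p} ∧
    -- compact positive operators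
    BPB.BPBppNu {T : H →L[ℂ] H | IsCompactOperator T ∧ T.IsPositive} ∧
    -- self-adjoint Schatten-von Neumann operators: likewise
    (∀ p : ℝ, 1 ≤ p → BPB.BPBppNu {T : H →L[ℂ] H | IsSelfAdjoint T ∧ T ∈ BPB.schattenClass H p}) ∧
    BPB.BPBppNu {T : H →L[ℂ] H | IsSelfAdjoint T ∧ ∃ p : ℝ, 1 ≤ p ∧ T ∈ BPB.schattenClass H p} ∧
    -- for positive `T`, the approximating operator is obtained by positive finite-rank perturbations
    (∀ ε : ℝ, 0 < ε → ε < 1 → ∃ η : ℝ, 0 < η ∧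
      ∀ T : H →L[ℂ] H, T.IsPositive → BPB.numericalRadius T = 1 →
        ∀ x₀ : H, ‖x₀‖ = 1 → 1 - η < ‖inner ℂ x₀ (T x₀)‖ →
          ∃ (x : ℕ → H) (xlim : H) (Tlim S : H →L[ℂ] H),
            (∀ n, ‖x n‖ = 1) ∧
            Tendsto x atTop (𝓝 xlim) ∧
            (∀ n, (BPB.finiteRankPerturbation (ε / 4) x n).IsPositive ∧
              (T + BPB.finiteRankPerturbation (ε / 4) x n).IsPositive) ∧
            Tendsto (fun n => T + BPB.finiteRankPerturbation (ε / 4) x n) atTop (𝓝 Tlim) ∧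
            Tendsto (fun n => BPB.numericalRadius (T + BPB.finiteRankPerturbation (ε / 4) x n))
              atTop (𝓝 (BPB.numericalRadius Tlim)) ∧
            Tendsto
              (fun n => ‖inner ℂ (x n) ((T + BPB.finiteRankPerturbation (ε / 4) x n) (x n))‖)
              atTop (𝓝 (BPB.numericalRadius Tlim)) ∧
            0 < BPB.numericalRadius Tlim ∧
            Tlim = (BPB.numericalRadius Tlim : ℂ) • S ∧
            S.IsPositive ∧ BPB.numericalRadius S = 1 ∧ inner ℂ xlim (S xlim) = 1 ∧
            ‖xlim‖ = 1 ∧ ‖xlim - x₀‖ < ε ∧ ‖S - T‖ < ε) := by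
  refine ⟨?_, fun p hp => ?_, ?_, ?_, fun p hp => ?_, ?_, fun ε hε hε1 => ?_⟩
  · refine BPB.bppNu_of_compression_mem (fun T hT => hT.isSelfAdjoint) fun T hT e he s hs hpos => ?_
    exact BPB.isPositive_compression (BPB.nonneg_of_mul_re_inner_pos hT hpos) e hT
  · refine BPB.bppNu_of_compression_mem (fun T hT => hT.1.isSelfAdjoint)
      fun T hT e he s hs hpos => ?_
    exact ⟨BPB.isPositive_compression (BPB.nonneg_of_mul_re_inner_pos hT.1 hpos) e hT.1,
      BPB.compression_mem_schattenClass hT.1.isSelfAdjoint hp hT.2 s he⟩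
  · refine BPB.bppNu_of_compression_mem (fun T hT => hT.1.isSelfAdjoint) ?_
    rintro T ⟨hT, p, hp, hTp⟩ e he s hs hpos
    exact ⟨BPB.isPositive_compression (BPB.nonneg_of_mul_re_inner_pos hT hpos) e hT,
      p, hp, BPB.compression_mem_schattenClass hT.isSelfAdjoint hp hTp s he⟩
  · refine BPB.bppNu_of_compression_mem (fun T hT => hT.2.isSelfAdjoint)
      fun T hT e he s hs hpos => ?_
    exact ⟨BPB.isCompactOperator_compression s e hT.1,
      BPB.isPositive_compression (BPB.nonneg_of_mul_re_inner_pos hT.2 hpos) e hT.2⟩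
  · refine BPB.bppNu_of_compression_mem (fun T hT => hT.1) fun T hT e he s hs hpos => ?_
    exact ⟨BPB.isSelfAdjoint_compression s e hT.1,
      BPB.compression_mem_schattenClass hT.1 hp hT.2 s he⟩
  · refine BPB.bppNu_of_compression_mem (fun T hT => hT.1) ?_
    rintro T ⟨hT, p, hp, hTp⟩ e he s hs hpos
    exact ⟨BPB.isSelfAdjoint_compression s e hT,
      p, hp, BPB.compression_mem_schattenClass hT hp hTp s he⟩
  · exact ⟨ε ^ 3 / 64, by positivity, fun T hT hν e he hη =>
      BPB.exists_perturbation_attaining hε hε1 hT hν he hη⟩
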